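/- Let $f_4:[0,1]\to[0,1]$, $f_4(x)=4x(1-x)$, where $[0,1]$ carries the distance $d(x,y)=|x-y|$. For $f:[0,1]\to[0,1]$ continuous, $A\subset[0,1]$, $\varepsilon>0$ and $n\in\mathbb N$, let $r_n(f,A,\varepsilon)$ be the smallest cardinality of a set $K\subset[0,1]$ such that for every $x\in A$ there is $y\in K$ with $d(f^ix,f^iy)<\varepsilon$ for $0\le i<n$. Put $h(f,\varepsilon)=\limsup_n\frac1n\log r_n(f,[0,1],\varepsilon)$ and $h(f)=\lim_{\varepsilon\to0}h(f,\varepsilon)$. Let $B_n(f,x,\varepsilon)=\{y: d(f^iy,f^ix)<\varepsilon,\ 0\le i<n\}$; for an $f$-invariant Borel probability measure $\mu$ put $$h_{\mathrm{loc}}(\mu,\varepsilon)=\lim_{\sigma\to1,\ \sigma<1}\ \inf_{F\text{ Borel},\ \mu(F)\ge\sigma}\ \lim_{\delta\to0}\ \limsup_{n\to\infty}\frac1n\log\sup_{x\in F}r_n(f,F\cap B_n(f,x,\varepsilon),\delta),$$ and let $h_{\mathrm{loc}}(f,\varepsilon)=\sup_\mu h_{\mathrm{loc}}(\mu,\varepsilon)$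 over all such $\mu$. A hyperbolic repeller of a $C^r$ map $f:[0,1]\to[0,1]$ is a nonempty compact set $\Lambda$ with $f(\Lambda)=\Lambda$, for which there are $C>0$, $\lambda>1$ with $|(f^n)'(x)|\ge C\lambda^n$ for all $x\in\Lambda$, $n\ge0$, and a neighbourhood $U$ such that every point whose forward orbit stays in $U$ lies in $\Lambda$. For $2\le r\le\infty$, a $C^r$ map $f$ has a non degenerate homoclinic tangency at $\Lambda$ if there is $c\in[0,1]$ with $f'(c)=0$ that is a local extremum of $f$ and such that: every neighbourhood $V$ of $\Lambda$ satisfies $c\in f^n(V)$ for some $n>0$; and, for some $k>0$, $f^k(c)\in\Lambda$ and $(f^k)^{(l)}(c)\ne0$ for some finite $l$ with $1\le l\le r$. (Derivatives are one-sided at the end points.) Then: 1. $0$ is a repelling fixed point of $f_4$, i.e. $f_4(0)=0$ and $|f_4'(0)|>1$, and for every $2\le r\le\infty$ the map $f_4$ has a non degenerate homoclinic tangency at the hyperbolic repeller $\{0\}$. 2. There is $C>0$ such that $h_{\mathrm{loc}}(f_4,\varepsilon)\ge C/|\log\varepsilon|$ for all $0<\varepsilon<\frac12$. 3. $h(f_4)$,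 $h(f_4,\varepsilon)$ and, for $0<\varepsilon<\frac12$, $h_{\mathrm{loc}}(f_4,\varepsilon)$ are finite (and $h_{\mathrm{loc}}(f_4,\varepsilon)<+\infty$ for all $\varepsilon>0$). For every $\alpha\in(0,1)$, as $\varepsilon\to0^+$, $$h(f_4)-h(f_4,\varepsilon)=o\!\left(\frac{\varepsilon^\alpha}{|\log\varepsilon|}\right).$$ 4. In particular $h(f_4)-h(f_4,\varepsilon)=o\big(h_{\mathrm{loc}}(f_4,\varepsilon)\big)$ as $\varepsilon\to0^+$, so the general inequality $h(f)-h(f,\varepsilon)\le h_{\mathrm{loc}}(f,\varepsilon)$ is far from sharp for $f_4$. -/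

import Mathlib

open Set Filter Topology MeasureTheory
open scoped ENNReal Asymptotics

noncomputable section

namespace EpsEntropy

/-! ### Entropies at a given scale -/

section Metric

variable {X : Type*} [MetricSpace X]

/-- The relation `d(x, y) < ε`. -/
def distRel (X : Type*) [MetricSpace X] (ε : ℝ) : SetRel X X := {p | dist p.1 p.2 < ε}

/-- `r_n(f, A, ε)`: the smallest cardinality of a set `K` of points of `X` such that every `x ∈ A`
admits `y ∈ K` with `d(f^i x, f^i y) < ε` for `0 ≤ i < n`. -/
def spanningNumber (f : X → X) (A : Set X) (ε : ℝ) (n : ℕ) : ℕ∞ :=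
  Dynamics.coverMincard f A (distRel X ε) n

/-- The `ε`-topological entropy of the whole space,
`h(f, ε) = limsup_n (1/n) log r_n(f, X, ε)`. -/
def scaleEntropy (f : X → X) (ε : ℝ) : EReal :=
  ExpGrowth.expGrowthSup fun n : ℕ => (spanningNumber f univ ε n : ℝ≥0∞)

/-- The topological entropy `h(f)` of the whole space. -/
def topEntropy (f : X → X) : EReal := Dynamics.coverEntropy f univ

/-- `h(f)` is the supremum over `ε > 0`, equivalently (`h(f, ε)` being nonincreasing in `ε`) the
limit as `ε → 0`, of `h(f, ε)`. -/
theorem topEntropy_eq_iSup (f : X → X) : topEntropy f = ⨆ (ε : ℝ) (_ : 0 < ε), scaleEntropy f ε :=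
  Dynamics.coverEntropy_eq_iSup_basis Metric.uniformity_basis_dist f univ

/-- The dynamical ball `B_n(f, x, ε)`: the `y` with `d(f^i y, f^i x) < ε` for `0 ≤ i < n`. -/
def dynBall (f : X → X) (x : X) (ε : ℝ) (n : ℕ) : Set X :=
  {y | ∀ i < n, dist (f^[i] y) (f^[i] x) < ε}

/-- `lim_{δ → 0} limsup_n (1/n) log sup_{x ∈ F} r_n(f, F ∩ B_n(f, x, ε), δ)`. The quantity under
the limit does not decrease when `δ` decreases, so that the limit is a supremum. -/
def tailEntropyOn (f : X → X) (F : Set X) (ε : ℝ) : EReal :=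
  ⨆ (δ : ℝ) (_ : 0 < δ), ExpGrowth.expGrowthSup fun n : ℕ =>
    ⨆ x ∈ F, (spanningNumber f (F ∩ dynBall f x ε n) δ n : ℝ≥0∞)

variable [MeasurableSpace X]

/-- The `ε`-local entropy of a measure `μ`,
`h_loc(μ, ε) = lim_{s → 1, s < 1} inf_{F Borel, μ(F) ≥ s} tailEntropyOn f F ε`. The infimum does not
decrease when `s` increases, so that the limit is a supremum. -/
def measureLocalEntropy (f : X → X) (μ : Measure X) (ε : ℝ) : EReal :=
  ⨆ (s : ℝ≥0∞) (_ : s < 1), ⨅ (F : Set X) (_ : MeasurableSet F) (_ : s ≤ μ F), tailEntropyOn f F ε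

/-- The `ε`-local entropy `h_loc(f, ε)`: the supremum of `h_loc(μ, ε)` over the `f`-invariant Borel
probability measures `μ`. -/
def localEntropy (f : X → X) (ε : ℝ) : EReal :=
  ⨆ (μ : Measure X) (_ : IsProbabilityMeasure μ) (_ : MeasurePreserving f μ μ),
    measureLocalEntropy f μ ε

end Metric

/-! ### Homoclinic tangencies of interval maps -/

/-- The map `[0,1] → [0,1]` seen as a real-valued function; its values off `[0,1]` play no role
below, all derivatives being taken within `[0,1]`. -/
def realExt (g : unitInterval → unitInterval) : ℝ → ℝ := Set.IccExtend zero_le_one fun x : unitInterval => (g x : ℝ)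

/-- The `l`-th derivative of `g : [0,1] → [0,1]` at `c` (one-sided at the end points). -/
def intervalDeriv (l : ℕ) (g : unitInterval → unitInterval) (c : unitInterval) : ℝ :=
  iteratedDerivWithin l (realExt g) (Icc (0 : ℝ) 1) c

/-- `f : [0,1] → [0,1]` is of class `C^r`, `r ≤ ∞`. -/
def IsCr (r : ℕ∞) (f : unitInterval → unitInterval) : Prop :=
  ContDiffOn ℝ (r : WithTop ℕ∞) (realExt f) (Icc (0 : ℝ) 1)

/-- A hyperbolic repeller: a nonempty compact invariant set, uniformly expanding, which is the set
of all points whose orbit stays in some neighbourhood of it. -/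
structure IsHyperbolicRepeller (f : unitInterval → unitInterval) (Λ : Set unitInterval) : Prop where
  nonempty : Λ.Nonempty
  isCompact : IsCompact Λ
  image_eq : f '' Λ = Λ
  expanding : ∃ C > (0 : ℝ), ∃ lam > (1 : ℝ), ∀ x ∈ Λ, ∀ n : ℕ,
    C * lam ^ n ≤ |intervalDeriv 1 f^[n] x|
  isolated : ∃ U ∈ 𝓝ˢ Λ, ∀ x, (∀ n : ℕ, f^[n] x ∈ U) → x ∈ Λ

/-- `W^u(Λ)`: the points `x` such that every neighbourhood `V` of `Λ` satisfies `x ∈ f^n(V)` for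
some `n > 0`. -/
def unstableSet (f : unitInterval → unitInterval) (Λ : Set unitInterval) : Set unitInterval :=
  {x | ∀ V ∈ 𝓝ˢ Λ, ∃ n > 0, x ∈ f^[n] '' V}

/-- The `C^r` interval map `f` has a non degenerate homoclinic tangency at the hyperbolic
repeller `Λ`. -/
def HasHomoclinicTangency (r : ℕ∞) (f : unitInterval → unitInterval) (Λ : Set unitInterval) : Prop :=
  IsCr r f ∧ IsHyperbolicRepeller f Λ ∧
    ∃ c : unitInterval, intervalDeriv 1 f c = 0 ∧ IsLocalExtr f c ∧ c ∈ unstableSet f Λ ∧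
      ∃ k > 0, f^[k] c ∈ Λ ∧ ∃ l : ℕ, 1 ≤ l ∧ (l : ℕ∞) ≤ r ∧ intervalDeriv l f^[k] c ≠ 0

/-! ### The quadratic map -/

/-- `f₄(x) = 4x(1 - x)` on `[0,1]`. -/
def f4 (x : unitInterval) : unitInterval :=
  ⟨4 * (x : ℝ) * (1 - x), by
    have h0 := x.2.1
    have h1 := x.2.2
    constructor
    · exact mul_nonneg (by linarith) (by linarith)
    · nlinarith [sq_nonneg (2 * (x : ℝ) - 1)]⟩

end EpsEntropy

end

/-! The map θ ↦ sin² θ semiconjugates angle doubling to `f4`. It is 1-Lipschitz, so a grid of about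
2^n angles spans at every scale, and all the entropies are at most log 2.

At scale ε almost nothing of log 2 is lost. Take the preimages of the fixed point 3/4 under f₄^n
whose orbits stay ε-away from 1/2. Just before two such orbits merge they are symmetric about 1/2,
hence 2ε apart (`avoidSet_separated`). Their number a_n doubles at each step except for the points
within 4ε² of 1. These then spend about log₂(1/ε) steps near 0, where `f4` is injective, so they are
no more numerous than the set that many steps earlier: a_{n+1} ≥ 2(a_n − a_{n−k−1}) with 2^k of
order 1/ε. The growth rate is then 2(1 − O(ε)), and h(f₄) − h(f₄, ε) = O(ε) = o(ε^α/|log ε|).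

The homoclinic tangency yields much local entropy. In angle coordinates the two maps t ↦ 1/2 ± t/2^k
are inverse branches of f₄^k near the critical point; they generate a two-symbol horseshoe of
entropy log 2 / k for `f4`, any two points of which stay forever within π/2^k of each other. For ε >
π/2^k a dynamical ball thus contains it all, so h_loc(f₄, ε) ≥ log 2 / k; taking k of order |log ε|
gives C/|log ε|, which dominates O(ε). -/

namespace EpsEntropy

/-! ### The semiconjugacy with angle doubling -/

/-- The point `sin² θ` of the unit interval. -/
noncomputable def sinSq (θ : ℝ) : unitInterval :=
  ⟨Real.sin θ ^ 2, sq_nonneg _, Real.sin_sq_le_one θ⟩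

@[simp] theorem coe_sinSq (θ : ℝ) : (sinSq θ : ℝ) = Real.sin θ ^ 2 := rfl

@[simp] theorem coe_f4 (x : unitInterval) : (f4 x : ℝ) = 4 * (x : ℝ) * (1 - x) := rfl

theorem continuous_sinSq : Continuous sinSq :=
  (Real.continuous_sin.pow 2).subtype_mk _

theorem continuous_f4 : Continuous f4 := by
  unfold f4
  exact Continuous.subtype_mk (by fun_prop) _

theorem f4_sinSq (θ : ℝ) : f4 (sinSq θ) = sinSq (2 * θ) := by
  ext
  simp only [coe_f4, coe_sinSq, Real.sin_two_mul]
  have := Real.sin_sq_add_cos_sq θ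
  rw [← this]
  ring

theorem f4_iterate_sinSq (n : ℕ) (θ : ℝ) : f4^[n] (sinSq θ) = sinSq (2 ^ n * θ) := by
  induction n with
  | zero => simp
  | succ n ih => rw [Function.iterate_succ_apply', ih, f4_sinSq]; ring_nf

theorem dist_sinSq_le (a b : ℝ) : dist (sinSq a) (sinSq b) ≤ |a - b| := by
  have h : Real.sin a ^ 2 - Real.sin b ^ 2 = Real.sin (a + b) * Real.sin (a - b) := by
    rw [Real.sin_add, Real.sin_sub]
    have ha := Real.sin_sq_add_cos_sq a
    have hb := Real.sin_sq_add_cos_sq b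
    linear_combination Real.sin b ^ 2 * ha - Real.sin a ^ 2 * hb
  rw [Subtype.dist_eq, Real.dist_eq, coe_sinSq, coe_sinSq, h, abs_mul]
  calc _ ≤ 1 * |a - b| := mul_le_mul (Real.abs_sin_le_one _) Real.abs_sin_le_abs (abs_nonneg _)
          zero_le_one
    _ = _ := one_mul _

theorem exists_sinSq_eq (x : unitInterval) : ∃ θ, 0 ≤ θ ∧ θ ≤ Real.pi / 2 ∧ sinSq θ = x := by
  refine ⟨Real.arcsin (√x), Real.arcsin_nonneg.2 (Real.sqrt_nonneg _), Real.arcsin_le_pi_div_two _, ?_⟩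
  ext
  rw [coe_sinSq, Real.sin_arcsin (by linarith [Real.sqrt_nonneg (x : ℝ)])
    (Real.sqrt_le_one.2 x.2.2), Real.sq_sqrt x.2.1]

/-! ### The homoclinic tangency -/

/-- The quadratic polynomial on the whole line. -/
def quadratic (x : ℝ) : ℝ := 4 * x * (1 - x)

theorem coe_f4_iterate (n : ℕ) (x : unitInterval) : (f4^[n] x : ℝ) = quadratic^[n] x := by
  induction n with
  | zero => rfl
  | succ n ih => rw [Function.iterate_succ_apply', Function.iterate_succ_apply', ← ih]; rfl

theorem realExt_f4_iterate_eqOn (n : ℕ) :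
    EqOn (realExt f4^[n]) quadratic^[n] (Icc (0 : ℝ) 1) := by
  intro x hx
  rw [realExt, IccExtend_of_mem _ _ hx, coe_f4_iterate]

theorem intervalDeriv_f4_iterate (l n : ℕ) (c : unitInterval) :
    intervalDeriv l f4^[n] c = iteratedDerivWithin l quadratic^[n] (Icc (0 : ℝ) 1) c :=
  iteratedDerivWithin_congr (realExt_f4_iterate_eqOn n) c.2

theorem hasDerivAt_quadratic (x : ℝ) : HasDerivAt quadratic (4 - 8 * x) x := by
  unfold quadratic
  convert! (((hasDerivAt_id x).const_mul 4).mul ((hasDerivAt_id x).const_sub 1)) using 1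
  simp
  ring

theorem intervalDeriv_one_of_hasDerivAt {n : ℕ} {c : unitInterval} {d : ℝ}
    (h : HasDerivAt quadratic^[n] d c) : intervalDeriv 1 f4^[n] c = d := by
  rw [intervalDeriv_f4_iterate, iteratedDerivWithin_one]
  exact h.hasDerivWithinAt.derivWithin (uniqueDiffOn_Icc_zero_one c c.2)

theorem intervalDeriv_one_f4_iterate_zero (n : ℕ) : intervalDeriv 1 f4^[n] 0 = 4 ^ n := by
  refine intervalDeriv_one_of_hasDerivAt ?_
  have h := hasDerivAt_quadratic 0
  norm_num at h
  exact HasDerivAt.iterate 0 h (by simp [quadratic]) n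

theorem f4_zero : f4 0 = 0 := by ext; simp

/-- On [0, 1/2] the map at least doubles its argument, so no nonzero orbit stays there: this
isolates the repeller {0}. -/
theorem two_pow_mul_le_f4_iterate (x : unitInterval) (n : ℕ)
    (h : ∀ i < n, (f4^[i] x : ℝ) ≤ 1 / 2) : 2 ^ n * (x : ℝ) ≤ f4^[n] x := by
  induction n with
  | zero => simp
  | succ n ih =>
    have h1 := ih fun i hi => h i (by omega)
    have h2 := h n (by omega)
    rw [Function.iterate_succ_apply', coe_f4]
    have h0 := (f4^[n] x).2.1
    rw [pow_succ]
    nlinarith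

theorem isHyperbolicRepeller_zero : IsHyperbolicRepeller f4 {0} where
  nonempty := singleton_nonempty 0
  isCompact := isCompact_singleton
  image_eq := by rw [image_singleton, f4_zero]
  expanding := ⟨1, one_pos, 4, by norm_num, by
    rintro x rfl n
    rw [intervalDeriv_one_f4_iterate_zero, one_mul]
    exact le_abs_self _⟩
  isolated := by
    refine ⟨{x | (x : ℝ) < 1 / 2}, ?_, fun x hx => ?_⟩
    · rw [nhdsSet_singleton]
      exact (isOpen_lt continuous_subtype_val continuous_const).mem_nhds (by simp)
    · by_contra hne
      have hpos : 0 < (x : ℝ) := lt_of_le_of_ne x.2.1 fun h => hne (Subtype.ext h.symm)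
      obtain ⟨n, hn⟩ := pow_unbounded_of_one_lt (1 / (x : ℝ)) one_lt_two
      have h1 := two_pow_mul_le_f4_iterate x n fun i _ => (hx i).le
      rw [div_lt_iff₀ hpos] at hn
      linarith [(f4^[n] x).2.2]

theorem sinSq_pi_div_four : (sinSq (Real.pi / 4) : ℝ) = 1 / 2 := by
  rw [coe_sinSq, Real.sin_pi_div_four, div_pow, Real.sq_sqrt zero_le_two]
  norm_num

/-- Halving the angle n times gives a point near 0 that n iterates bring back, so the unstable set
of {0} is the whole interval. -/
theorem sinSq_mem_unstableSet (θ : ℝ) : sinSq θ ∈ unstableSet f4 {0} := by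
  intro V hV
  rw [nhdsSet_singleton] at hV
  have hlim : Tendsto (fun n : ℕ => sinSq (θ * (1 / 2) ^ n)) atTop (𝓝 0) := by
    have h1 : Tendsto (fun n : ℕ => θ * (1 / 2 : ℝ) ^ n) atTop (𝓝 0) := by
      simpa using (tendsto_pow_atTop_nhds_zero_of_lt_one (by norm_num : (0 : ℝ) ≤ 1 / 2)
        (by norm_num)).const_mul θ
    have h2 := (continuous_sinSq.tendsto 0).comp h1
    have h3 : sinSq 0 = 0 := by ext; simp
    rwa [h3] at h2
  obtain ⟨n, hn, hn0⟩ := ((hlim.eventually_mem hV).and (eventually_gt_atTop 0)).exists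
  refine ⟨n, hn0, _, hn, ?_⟩
  rw [f4_iterate_sinSq]
  congr 1
  rw [mul_left_comm, ← mul_pow]
  norm_num

theorem hasDerivAt_quadratic_iterate_two (x : ℝ) :
    HasDerivAt quadratic^[2] ((4 - 8 * quadratic x) * (4 - 8 * x)) x :=
  (hasDerivAt_quadratic (quadratic x)).comp x (hasDerivAt_quadratic x)

theorem intervalDeriv_two_f4_iterate_two {c : unitInterval} (hc : (c : ℝ) = 1 / 2) :
    intervalDeriv 2 f4^[2] c = 32 := by
  rw [intervalDeriv_f4_iterate, iteratedDerivWithin_succ]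
  have h1 : EqOn (iteratedDerivWithin 1 quadratic^[2] (Icc (0 : ℝ) 1))
      (fun x => (4 - 8 * quadratic x) * (4 - 8 * x)) (Icc (0 : ℝ) 1) := by
    intro x hx
    rw [iteratedDerivWithin_one]
    exact (hasDerivAt_quadratic_iterate_two x).hasDerivWithinAt.derivWithin
      (uniqueDiffOn_Icc_zero_one x hx)
  rw [derivWithin_congr h1 (h1 c.2)]
  have h2 : HasDerivAt (fun x => (4 - 8 * quadratic x) * (4 - 8 * x)) 32 (c : ℝ) := by
    convert! (((hasDerivAt_quadratic c).const_mul 8).const_sub 4).mul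
      (((hasDerivAt_id (c : ℝ)).const_mul 8).const_sub 4) using 1
    simp [quadratic, hc]
    norm_num
  exact h2.hasDerivWithinAt.derivWithin (uniqueDiffOn_Icc_zero_one c c.2)

theorem isCr_f4 (r : ℕ∞) : IsCr r f4 := by
  have h : ContDiff ℝ (r : WithTop ℕ∞) quadratic := by unfold quadratic; fun_prop
  exact h.contDiffOn.congr (realExt_f4_iterate_eqOn 1)

theorem hasHomoclinicTangency_f4 (r : ℕ∞) (hr : 2 ≤ r) : HasHomoclinicTangency r f4 {0} := by
  -- The tangency is at 1/2 = sin²(π/4), which reaches 0 after two iterates; the second derivative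
  -- of f₄² there is 32, so l = 2 works.
  refine ⟨isCr_f4 r, isHyperbolicRepeller_zero, sinSq (Real.pi / 4), ?_, ?_,
    sinSq_mem_unstableSet _, 2, two_pos, ?_, 2, one_le_two, hr, ?_⟩
  · refine intervalDeriv_one_of_hasDerivAt (n := 1) ?_
    rw [Function.iterate_one]
    convert hasDerivAt_quadratic _ using 1
    rw [sinSq_pi_div_four]
    norm_num
  · refine Or.inr (Eventually.of_forall fun x => ?_)
    rw [← Subtype.coe_le_coe, coe_f4, coe_f4, sinSq_pi_div_four]
    nlinarith [sq_nonneg (2 * (x : ℝ) - 1)]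
  · rw [f4_iterate_sinSq, show (2 : ℝ) ^ 2 * (Real.pi / 4) = Real.pi by ring]
    ext
    simp
  · rw [intervalDeriv_two_f4_iterate_two sinSq_pi_div_four]
    norm_num

/-! ### Estimates of spanning numbers -/

section Spanning

variable {X : Type*} [MetricSpace X]

theorem mem_dynEntourage_distRel {f : X → X} {ε : ℝ} {n : ℕ} {x y : X} :
    (x, y) ∈ Dynamics.dynEntourage f (distRel X ε) n ↔ ∀ i < n, dist (f^[i] x) (f^[i] y) < ε :=
  Dynamics.mem_dynEntourage

theorem spanningNumber_le_card {f : X → X} {A : Set X} {ε : ℝ} {n : ℕ} (s : Finset X)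
    (h : ∀ x ∈ A, ∃ y ∈ s, ∀ i < n, dist (f^[i] x) (f^[i] y) < ε) :
    spanningNumber f A ε n ≤ s.card := by
  refine Dynamics.IsDynCoverOf.coverMincard_le_card fun x hx => ?_
  obtain ⟨y, hy, hxy⟩ := h x hx
  exact ⟨y, hy, mem_dynEntourage_distRel.2 hxy⟩

theorem le_spanningNumber {f : X → X} {A : Set X} {ε : ℝ} {n : ℕ} {m : ℕ∞}
    (h : ∀ s : Finset X, (∀ x ∈ A, ∃ y ∈ s, ∀ i < n, dist (f^[i] x) (f^[i] y) < ε) →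
      m ≤ s.card) : m ≤ spanningNumber f A ε n := by
  refine le_iInf₂ fun s hs => h s fun x hx => ?_
  obtain ⟨y, hy, hxy⟩ := hs hx
  exact ⟨y, hy, mem_dynEntourage_distRel.1 hxy⟩

theorem spanningNumber_mono {f : X → X} {A B : Set X} (h : A ⊆ B) (ε : ℝ) (n : ℕ) :
    spanningNumber f A ε n ≤ spanningNumber f B ε n :=
  le_spanningNumber fun s hs => spanningNumber_le_card s fun x hx => hs x (h hx)

/-- The points of a `(n, 2ε)`-separated set lie in distinct `(n, ε)`-balls. -/
theorem ncard_le_spanningNumber {f : X → X} {A P : Set X} {ε : ℝ} {n : ℕ} (hPA : P ⊆ A)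
    (hP : ∀ x ∈ P, ∀ y ∈ P, x ≠ y → ∃ i < n, 2 * ε ≤ dist (f^[i] x) (f^[i] y)) :
    (P.ncard : ℕ∞) ≤ spanningNumber f A ε n := by
  refine le_spanningNumber fun s hs => ?_
  choose! g hgs hg using fun x hx => hs x (hPA hx)
  rw [Nat.cast_le, ← ncard_coe_finset]
  refine ncard_le_ncard_of_injOn g hgs (fun x hx y hy hxy => ?_) s.finite_toSet
  by_contra hne
  obtain ⟨i, hi, hd⟩ := hP x hx y hy hne
  have h1 := hg x hx i hi
  have h2 := hg y hy i hi
  rw [hxy] at h1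
  linarith [dist_triangle_right (f^[i] x) (f^[i] y) (f^[i] (g y))]

theorem scaleEntropy_le_topEntropy (f : X → X) {ε : ℝ} (hε : 0 < ε) :
    scaleEntropy f ε ≤ topEntropy f := by
  rw [topEntropy_eq_iSup]
  exact le_iSup₂ (f := fun (ε : ℝ) (_ : 0 < ε) => scaleEntropy f ε) ε hε

theorem scaleEntropy_nonneg [Nonempty X] (f : X → X) (ε : ℝ) : 0 ≤ scaleEntropy f ε :=
  Dynamics.coverEntropyEntourage_nonneg f univ_nonempty (distRel X ε)

theorem localEntropy_le_topEntropy [MeasurableSpace X] (f : X → X) (ε : ℝ) :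
    localEntropy f ε ≤ topEntropy f := by
  refine iSup_le fun μ => iSup₂_le fun hμ _ => iSup₂_le fun s hs => ?_
  -- The infimum over F is bounded by its value at the whole space.
  refine iInf_le_of_le univ (iInf₂_le_of_le .univ (by rw [measure_univ]; exact hs.le) ?_)
  refine iSup₂_le fun δ hδ => (ExpGrowth.expGrowthSup_monotone fun n => ?_).trans
    (scaleEntropy_le_topEntropy f hδ)
  exact iSup₂_le fun x _ => ENat.toENNReal_mono (spanningNumber_mono (subset_univ _) δ n)

end Spanning

/-! ### The entropy of the quadratic map is at most `log 2` -/

/-- Before time n, doubling expands angles by at most 2^n, so a grid of [0, π/2] with mesh δ/2^n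
suffices. -/
theorem spanningNumber_f4_le {δ : ℝ} (hδ : 0 < δ) :
    ∃ M : ℕ, ∀ n, spanningNumber f4 univ δ n ≤ (M * 2 ^ n : ℕ) := by
  obtain ⟨M, hM⟩ := exists_nat_ge (Real.pi / 2 / δ)
  refine ⟨M + 1, fun n => ?_⟩
  have hpow : (0 : ℝ) < 2 ^ n := by positivity
  set h : ℝ := δ / 2 ^ n with hh
  have hhpos : 0 < h := by positivity
  classical
  let s : Finset unitInterval := (Finset.range (M * 2 ^ n + 1)).image fun j : ℕ => sinSq (j * h)
  have hcard : s.card ≤ (M + 1) * 2 ^ n := by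
    refine Finset.card_image_le.trans ?_
    rw [Finset.card_range, add_mul, one_mul]
    exact Nat.add_le_add_left Nat.one_le_two_pow _
  refine (spanningNumber_le_card s fun x _ => ?_).trans (by exact_mod_cast hcard)
  obtain ⟨θ, h0, h1, rfl⟩ := exists_sinSq_eq x
  have hfl := Nat.floor_le (show 0 ≤ θ / h by positivity)
  have hlt := Nat.lt_floor_add_one (θ / h)
  rw [le_div_iff₀ hhpos] at hfl
  rw [div_lt_iff₀ hhpos] at hlt
  refine ⟨_, Finset.mem_image_of_mem _ (a := ⌊θ / h⌋₊) ?_, fun i hi => ?_⟩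
  · rw [Finset.mem_range, Nat.lt_succ_iff]
    refine Nat.floor_le_of_le ?_
    push_cast
    rw [div_le_iff₀ hhpos, hh, mul_assoc, mul_div_cancel₀ _ hpow.ne']
    rw [div_le_iff₀ hδ] at hM
    linarith
  · rw [f4_iterate_sinSq, f4_iterate_sinSq]
    refine (dist_sinSq_le _ _).trans_lt ?_
    have h2i : (2 : ℝ) ^ i ≤ 2 ^ n := pow_le_pow_right₀ one_le_two hi.le
    have hpi : (0 : ℝ) < 2 ^ i := by positivity
    rw [← mul_sub, abs_of_nonneg (mul_nonneg hpi.le (by linarith))]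
    calc (2 : ℝ) ^ i * (θ - ⌊θ / h⌋₊ * h) < 2 ^ i * h :=
          mul_lt_mul_of_pos_left (by linarith) hpi
      _ ≤ 2 ^ n * h := mul_le_mul_of_nonneg_right h2i hhpos.le
      _ = δ := by rw [hh]; field_simp

theorem log_two_eq : ENNReal.log 2 = ((Real.log 2 : ℝ) : EReal) := by
  rw [← ENNReal.log_ofReal_of_pos two_pos, ENNReal.ofReal_ofNat]

theorem scaleEntropy_f4_le {δ : ℝ} (hδ : 0 < δ) :
    scaleEntropy f4 δ ≤ ((Real.log 2 : ℝ) : EReal) := by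
  obtain ⟨M, hM⟩ := spanningNumber_f4_le hδ
  rw [← log_two_eq, ← ExpGrowth.expGrowthSup_pow]
  refine ExpGrowth.expGrowthSup_le_of_eventually_le (b := M) (ENNReal.natCast_ne_top M)
    (Eventually.of_forall fun n => ?_)
  refine (ENat.toENNReal_mono (hM n)).trans (le_of_eq ?_)
  rw [ENat.toENNReal_coe]
  push_cast
  rfl

theorem topEntropy_f4_le : topEntropy f4 ≤ ((Real.log 2 : ℝ) : EReal) := by
  rw [topEntropy_eq_iSup]
  exact iSup₂_le fun δ hδ => scaleEntropy_f4_le hδ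

/-! ### Orbit segments avoiding a neighbourhood of the critical point -/

/-- The preimages under `f₄^n` of the fixed point `3/4` the orbits of which stay, before time `n`,
at distance at least `ε` from the critical point `1/2`. -/
def avoidSet (ε : ℝ) (n : ℕ) : Set unitInterval :=
  {x | (f4^[n] x : ℝ) = 3 / 4 ∧ ∀ i < n, ε ≤ |(f4^[i] x : ℝ) - 1 / 2|}

theorem eq_or_eq_one_sub_of_f4_eq {x y : unitInterval} (h : f4 x = f4 y) :
    x = y ∨ (y : ℝ) = 1 - x := by
  have h1 : 4 * (x : ℝ) * (1 - x) = 4 * y * (1 - y) := congrArg Subtype.val h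
  have h2 : ((x : ℝ) - y) * (y - (1 - x)) = 0 := by linear_combination -(1 / 4) * h1
  rcases mul_eq_zero.1 h2 with h3 | h3
  · exact Or.inl (Subtype.ext (sub_eq_zero.1 h3))
  · exact Or.inr (sub_eq_zero.1 h3)

/-- Both orbits end at 3/4. One step before they first coincide they are distinct points with the
same image, hence symmetric about 1/2, and each is at distance at least ε from it. -/
theorem avoidSet_separated {ε : ℝ} {n : ℕ} {x y : unitInterval} (hx : x ∈ avoidSet ε n)
    (hy : y ∈ avoidSet ε n) (hne : x ≠ y) : ∃ i < n, 2 * ε ≤ dist (f4^[i] x) (f4^[i] y) := by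
  have hex : ∃ i, f4^[i] x = f4^[i] y := ⟨n, Subtype.ext (hx.1.trans hy.1.symm)⟩
  classical
  have hpos : Nat.find hex ≠ 0 := fun h => hne (by simpa [h] using Nat.find_spec hex)
  obtain ⟨i, hi⟩ := Nat.exists_eq_succ_of_ne_zero hpos
  have hle : Nat.find hex ≤ n := Nat.find_min' hex (Subtype.ext (hx.1.trans hy.1.symm))
  have hspec := Nat.find_spec hex
  have hmin := Nat.find_min hex (show i < Nat.find hex by omega)
  rw [hi, Function.iterate_succ_apply', Function.iterate_succ_apply'] at hspec
  refine ⟨i, by omega, ?_⟩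
  have h1 := (eq_or_eq_one_sub_of_f4_eq hspec).resolve_left hmin
  have h2 := hx.2 i (by omega)
  rw [Subtype.dist_eq, Real.dist_eq, h1,
    show (f4^[i] x : ℝ) - (1 - f4^[i] x) = 2 * (f4^[i] x - 1 / 2) by ring, abs_mul, abs_two]
  linarith

/-- The inverse branches of `f₄`, for `s = -1` and `s = 1`. -/
noncomputable def inverseBranch (s : ℝ) (hs : |s| = 1) (x : unitInterval) : unitInterval :=
  ⟨1 / 2 + s * (√(1 - x) / 2), by
    have h1 : √(1 - (x : ℝ)) ≤ 1 := Real.sqrt_le_one.2 (by linarith [x.2.1])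
    have h0 := Real.sqrt_nonneg (1 - (x : ℝ))
    rcases (abs_eq zero_le_one).1 hs with rfl | rfl <;> constructor <;> linarith⟩

theorem coe_inverseBranch {s : ℝ} (hs : |s| = 1) (x : unitInterval) :
    (inverseBranch s hs x : ℝ) = 1 / 2 + s * (√(1 - x) / 2) := rfl

theorem f4_inverseBranch {s : ℝ} (hs : |s| = 1) (x : unitInterval) :
    f4 (inverseBranch s hs x) = x := by
  ext
  rw [coe_f4, coe_inverseBranch]
  have h1 : √(1 - (x : ℝ)) ^ 2 = 1 - x := Real.sq_sqrt (by linarith [x.2.2])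
  have h2 : s ^ 2 = 1 := by rw [← sq_abs, hs, one_pow]
  linear_combination -s ^ 2 * h1 - (1 - (x : ℝ)) * h2

theorem abs_inverseBranch_sub {s : ℝ} (hs : |s| = 1) (x : unitInterval) :
    |(inverseBranch s hs x : ℝ) - 1 / 2| = √(1 - x) / 2 := by
  rw [coe_inverseBranch, add_sub_cancel_left, abs_mul, hs, one_mul,
    abs_of_nonneg (by positivity)]

theorem le_abs_inverseBranch_sub_iff {ε s : ℝ} (hε : 0 < ε) (hs : |s| = 1) (x : unitInterval) :
    ε ≤ |(inverseBranch s hs x : ℝ) - 1 / 2| ↔ (x : ℝ) ≤ 1 - 4 * ε ^ 2 := by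
  rw [abs_inverseBranch_sub, le_div_iff₀ two_pos, Real.le_sqrt' (by positivity)]
  constructor <;> intro h <;> nlinarith

theorem eq_inverseBranch_f4 (y : unitInterval) :
    y = inverseBranch (-1) (by simp) (f4 y) ∨ y = inverseBranch 1 (by simp) (f4 y) := by
  rcases eq_or_eq_one_sub_of_f4_eq (f4_inverseBranch (s := 1) (by simp) (f4 y)).symm with h | h
  · exact Or.inr h
  · left
    ext
    rw [coe_inverseBranch] at h ⊢
    linarith

/-- The points of `avoidSet ε n` both preimages of which are at distance at least `ε` of `1/2`. -/
def avoidSetLow (ε : ℝ) (n : ℕ) : Set unitInterval := {x ∈ avoidSet ε n | (x : ℝ) ≤ 1 - 4 * ε ^ 2}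

theorem mem_avoidSet_succ {ε : ℝ} {n : ℕ} {x : unitInterval} :
    x ∈ avoidSet ε (n + 1) ↔ f4 x ∈ avoidSet ε n ∧ ε ≤ |(x : ℝ) - 1 / 2| := by
  simp only [avoidSet, mem_ofPred_eq, Function.iterate_succ_apply]
  constructor
  · rintro ⟨h1, h2⟩
    exact ⟨⟨h1, fun i hi => by simpa using h2 (i + 1) (by omega)⟩, by simpa using h2 0 (by omega)⟩
  · rintro ⟨⟨h1, h2⟩, h3⟩
    refine ⟨h1, fun i hi => ?_⟩
    cases i with
    | zero => simpa using h3
    | succ i => simpa using h2 i (by omega)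

theorem avoidSet_succ {ε : ℝ} (hε : 0 < ε) (n : ℕ) :
    avoidSet ε (n + 1) = inverseBranch (-1) (by simp) '' avoidSetLow ε n ∪
      inverseBranch 1 (by simp) '' avoidSetLow ε n := by
  ext y
  rw [mem_avoidSet_succ]
  constructor
  · rintro ⟨h1, h2⟩
    rcases eq_inverseBranch_f4 y with h | h
    · refine Or.inl ⟨f4 y, ⟨h1, ?_⟩, h.symm⟩
      rw [h, le_abs_inverseBranch_sub_iff hε] at h2
      exact h2
    · refine Or.inr ⟨f4 y, ⟨h1, ?_⟩, h.symm⟩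
      rw [h, le_abs_inverseBranch_sub_iff hε] at h2
      exact h2
  · rintro (⟨x, ⟨h1, h2⟩, rfl⟩ | ⟨x, ⟨h1, h2⟩, rfl⟩)
    all_goals
      rw [f4_inverseBranch, le_abs_inverseBranch_sub_iff hε]
      exact ⟨h1, h2⟩

theorem avoidSet_zero (ε : ℝ) :
    avoidSet ε 0 = {(⟨3 / 4, by norm_num, by norm_num⟩ : unitInterval)} := by
  ext x
  simp [avoidSet, Subtype.ext_iff]

theorem finite_avoidSet {ε : ℝ} (hε : 0 < ε) (n : ℕ) : (avoidSet ε n).Finite := by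
  induction n with
  | zero => rw [avoidSet_zero]; exact finite_singleton _
  | succ n ih =>
    rw [avoidSet_succ hε]
    have h : (avoidSetLow ε n).Finite := ih.subset (sep_subset _ _)
    exact (h.image _).union (h.image _)

/-- The two inverse branches are injective, and their images are disjoint because the only common
value, 1/2, comes from x = 1, which is not low. -/
theorem ncard_avoidSet_succ {ε : ℝ} (hε : 0 < ε) (n : ℕ) :
    (avoidSet ε (n + 1)).ncard = 2 * (avoidSetLow ε n).ncard := by
  have hfin : (avoidSetLow ε n).Finite := (finite_avoidSet hε n).subset (sep_subset _ _)
  have hinj {s : ℝ} (hs : |s| = 1) : Function.Injective (inverseBranch s hs) :=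
    Function.LeftInverse.injective (g := f4) (f4_inverseBranch hs)
  rw [avoidSet_succ hε, ncard_union_eq ?_ (hfin.image _) (hfin.image _),
    ncard_image_of_injective _ (hinj _), ncard_image_of_injective _ (hinj _), two_mul]
  rw [disjoint_left]
  rintro _ ⟨x, hx, rfl⟩ ⟨y, hy, hxy⟩
  have h1 : y = x := by simpa [f4_inverseBranch] using congrArg f4 hxy
  subst h1
  have h2 := congrArg Subtype.val hxy
  rw [coe_inverseBranch, coe_inverseBranch] at h2
  have h3 : 0 < √(1 - (y : ℝ)) := Real.sqrt_pos.2 (by nlinarith [hy.2])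
  linarith

theorem f4_iterate_injOn_left {k : ℕ} {u v : unitInterval}
    (hu : ∀ i < k, (f4^[i] u : ℝ) < 1 / 2) (hv : ∀ i < k, (f4^[i] v : ℝ) < 1 / 2)
    (h : f4^[k] u = f4^[k] v) : u = v := by
  induction k with
  | zero => simpa using h
  | succ k ih =>
    refine ih (fun i hi => hu i (by omega)) (fun i hi => hv i (by omega)) ?_
    rw [Function.iterate_succ_apply', Function.iterate_succ_apply'] at h
    refine (eq_or_eq_one_sub_of_f4_eq h).resolve_right fun h1 => ?_
    linarith [hu k (by omega), hv k (by omega)]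

theorem f4_iterate_le (x : unitInterval) (n : ℕ) : (f4^[n] x : ℝ) ≤ 4 ^ n * x := by
  induction n with
  | zero => simp
  | succ n ih =>
    rw [Function.iterate_succ_apply', coe_f4, pow_succ]
    nlinarith [(f4^[n] x).2.1]

/-- A point within 4ε² of 1 is sent below 16ε², and each further step multiplies by at most 4. -/
theorem f4_iterate_lt_half {ε : ℝ} {k i : ℕ} (hk : 2 ^ (k + 1) * ε ≤ 1 / 2)
    (hε : 0 < ε) (hi : i < k) {x : unitInterval} (hx : 1 - 4 * ε ^ 2 < (x : ℝ)) :
    (f4^[i] (f4 x) : ℝ) < 1 / 2 := by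
  have h1 : (f4 x : ℝ) < 16 * ε ^ 2 := by
    rw [coe_f4]
    nlinarith [x.2.1, x.2.2]
  have h2 : (4 : ℝ) ^ (i + 2) ≤ 4 ^ (k + 1) := pow_le_pow_right₀ (by norm_num) (by omega)
  have h3 : (4 : ℝ) ^ (k + 1) * ε ^ 2 ≤ 1 / 4 := by
    have h4 : (4 : ℝ) ^ (k + 1) * ε ^ 2 = (2 ^ (k + 1) * ε) ^ 2 := by
      rw [mul_pow, ← pow_mul, mul_comm (k + 1), pow_mul]
      norm_num
    rw [h4]
    have h5 : 0 ≤ 2 ^ (k + 1) * ε := by positivity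
    nlinarith
  calc (f4^[i] (f4 x) : ℝ) ≤ 4 ^ i * (f4 x : ℝ) := f4_iterate_le _ _
    _ ≤ 4 ^ i * (16 * ε ^ 2) := mul_le_mul_of_nonneg_left h1.le (by positivity)
    _ = 4 ^ (i + 2) * ε ^ 2 := by ring
    _ ≤ 4 ^ (k + 1) * ε ^ 2 := mul_le_mul_of_nonneg_right h2 (sq_nonneg ε)
    _ < 1 / 2 := by linarith

/-- The points of `avoidSet ε n` close to `1`. -/
def avoidSetHigh (ε : ℝ) (n : ℕ) : Set unitInterval :=
  {x ∈ avoidSet ε n | 1 - 4 * ε ^ 2 < (x : ℝ)}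

theorem ncard_avoidSet_eq {ε : ℝ} (hε : 0 < ε) (n : ℕ) :
    (avoidSet ε n).ncard = (avoidSetLow ε n).ncard + (avoidSetHigh ε n).ncard := by
  have hfin := finite_avoidSet hε n
  rw [← ncard_union_eq (s := avoidSetLow ε n) (t := avoidSetHigh ε n) ?_
    (hfin.subset (sep_subset _ _)) (hfin.subset (sep_subset _ _))]
  · congr 1
    ext x
    simp only [avoidSetLow, avoidSetHigh, mem_union, mem_sep_iff, ← and_or_left]
    simp [le_or_gt]
  · rw [disjoint_left]
    exact fun x h1 h2 => h2.2.not_ge h1.2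

/-- A point too close to 1 is in the left half at times 1, …, k, so it cannot be at 3/4 at such a
time; at time 0 the point 3/4 itself is not that close to 1. -/
theorem avoidSetHigh_eq_empty {ε : ℝ} {k n : ℕ} (hk : 2 ^ (k + 1) * ε ≤ 1 / 2) (hε : 0 < ε)
    (hn : n ≤ k) : avoidSetHigh ε n = ∅ := by
  refine eq_empty_of_forall_notMem fun x hx => ?_
  cases n with
  | zero =>
    have h1 : (x : ℝ) = 3 / 4 := hx.1.1
    have h2 : (1 : ℝ) ≤ 2 ^ k := one_le_pow₀ one_le_two
    have h3 := hx.2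
    have h4 : ε ≤ 1 / 4 := by
      rw [pow_succ] at hk
      nlinarith
    nlinarith
  | succ n =>
    have h1 := hx.1.1
    have h2 := f4_iterate_lt_half hk hε (show n < k by omega) hx.2
    rw [Function.iterate_succ_apply] at h1
    linarith

/-- On points close to 1, f₄^(k+1) is injective: the first step is, as they all lie right of 1/2,
and the k following ones take place in the left half. It maps into `avoidSet ε n`. -/
theorem ncard_avoidSetHigh_le {ε : ℝ} {k : ℕ} (hk : 2 ^ (k + 1) * ε ≤ 1 / 2) (hε : 0 < ε)
    (n : ℕ) : (avoidSetHigh ε (n + (k + 1))).ncard ≤ (avoidSet ε n).ncard := by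
  refine ncard_le_ncard_of_injOn f4^[k + 1] (fun x hx => ⟨?_, fun i hi => ?_⟩)
    (fun x hx y hy hxy => ?_) (finite_avoidSet hε n)
  · rw [← Function.iterate_add_apply]
    exact hx.1.1
  · rw [← Function.iterate_add_apply]
    exact hx.1.2 _ (by omega)
  · rw [Function.iterate_succ_apply, Function.iterate_succ_apply] at hxy
    have h1 := f4_iterate_injOn_left (fun i hi => f4_iterate_lt_half hk hε hi hx.2)
      (fun i hi => f4_iterate_lt_half hk hε hi hy.2) hxy
    refine (eq_or_eq_one_sub_of_f4_eq h1).resolve_right fun h2 => ?_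
    have h3 : (1 : ℝ) ≤ 2 ^ k := one_le_pow₀ one_le_two
    have h4 : ε ≤ 1 / 4 := by
      rw [pow_succ] at hk
      nlinarith
    have h5 := hx.2
    have h6 := hy.2
    nlinarith

/-- A sequence with `a (n + 1) ≥ 2 (a n - a (n - j))` grows at least like `λ ^ n`, where
`λ = 2 (1 - η)` and `λ ^ (-j) ≤ η`. -/
theorem pow_le_of_delayed_recursion {a : ℕ → ℝ} {j : ℕ} {η : ℝ} (h0 : a 0 = 1) (hη0 : 0 ≤ η)
    (hη : η < 1) (hηj : 1 ≤ η * (2 * (1 - η)) ^ j) (h1 : ∀ n < j, a (n + 1) = 2 * a n)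
    (h2 : ∀ n, 2 * (a (n + j) - a n) ≤ a (n + j + 1)) (n : ℕ) : (2 * (1 - η)) ^ n ≤ a n := by
  have hl : 0 < 2 * (1 - η) := by linarith
  -- The ratio bound is proved by strong induction: iterated over j steps it gives λ^j a_m ≤
  -- a_{m+j}, so the subtracted term a_m is at most η a_{m+j}.
  have key : ∀ n, 0 < a n ∧ 2 * (1 - η) * a n ≤ a (n + 1) := by
    intro n
    induction n using Nat.strong_induction_on with
    | _ n ih =>
      have hpos : 0 < a n := by
        cases n with
        | zero => rw [h0]; exact one_pos
        | succ n =>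
          obtain ⟨h3, h4⟩ := ih n (by omega)
          exact (mul_pos hl h3).trans_le h4
      refine ⟨hpos, ?_⟩
      rcases lt_or_ge n j with hn | hn
      · rw [h1 n hn]
        nlinarith
      · obtain ⟨m, rfl⟩ := Nat.exists_eq_add_of_le' hn
        have h3 : ∀ i ≤ j, (2 * (1 - η)) ^ i * a m ≤ a (m + i) := by
          intro i
          induction i with
          | zero => simp
          | succ i ihi =>
            intro hi
            have h4 := (ih (m + i) (by omega)).2
            have h5 := ihi (by omega)
            rw [pow_succ', mul_assoc]
            exact (mul_le_mul_of_nonneg_left h5 hl.le).trans h4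
        have h4 := h3 j le_rfl
        have h5 := h2 m
        have h6 : 0 ≤ a m := by
          rcases Nat.eq_zero_or_pos j with rfl | hj
          · exact hpos.le
          · exact (ih m (by omega)).1.le
        have h7 : a m ≤ η * a (m + j) := by nlinarith
        linarith
  induction n with
  | zero => simp [h0]
  | succ n ih =>
    rw [pow_succ']
    exact (mul_le_mul_of_nonneg_left ih hl.le).trans (key n).2

theorem pow_le_ncard_avoidSet {ε : ℝ} {k : ℕ} (hk3 : 3 ≤ k) (hk : 2 ^ (k + 1) * ε ≤ 1 / 2)
    (hε : 0 < ε) (n : ℕ) :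
    (2 * (1 - 2 / 2 ^ (k + 1) : ℝ)) ^ n ≤ (avoidSet ε n).ncard := by
  have hbig : 4 * ((k : ℝ) + 1) ≤ 2 ^ (k + 1) := by
    have h : 4 * (k + 1) ≤ 2 ^ (k + 1) := by
      induction k, hk3 using Nat.le_induction with
      | base => norm_num
      | succ k hk3 ih =>
        have := ih (by rw [pow_succ] at hk; nlinarith [show (0 : ℝ) < 2 ^ (k + 1) * ε by positivity])
        rw [pow_succ]
        omega
    exact_mod_cast h
  have hp : (0 : ℝ) < 2 ^ (k + 1) := by positivity
  have hk0 : (3 : ℝ) ≤ k := by exact_mod_cast hk3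
  have hη1 : (2 / 2 ^ (k + 1) : ℝ) < 1 := by
    rw [div_lt_one hp]
    linarith
  refine pow_le_of_delayed_recursion (a := fun n => ((avoidSet ε n).ncard : ℝ)) (j := k + 1) ?_
    (by positivity) hη1 ?_ (fun n hn => ?_) (fun n => ?_) n
  · simp [avoidSet_zero]
  -- With η = 2/2^(k+1) the condition reads 2(1 − η)^(k+1) ≥ 1. Bernoulli's inequality gives it,
  -- since (k+1)η ≤ 1/2 once k ≥ 3.
  · have hb := one_add_mul_le_pow (a := -(2 / 2 ^ (k + 1) : ℝ)) (by linarith) (k + 1)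
    have h1 : (1 : ℝ) / 2 ≤ 1 + ((k + 1 : ℕ) : ℝ) * -(2 / 2 ^ (k + 1)) := by
      have : ((k : ℝ) + 1) * (2 / 2 ^ (k + 1)) ≤ 1 / 2 := by
        rw [← mul_div_assoc, div_le_iff₀ hp]
        linarith
      push_cast
      linarith
    rw [mul_pow, ← mul_assoc, div_mul_cancel₀ _ hp.ne', sub_eq_add_neg]
    linarith
  · rw [ncard_avoidSet_succ hε, ncard_avoidSet_eq hε n,
      avoidSetHigh_eq_empty hk hε (by omega : n ≤ k)]
    simp
  · have h1 := ncard_avoidSetHigh_le hk hε n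
    have h2 := ncard_avoidSet_succ hε (n + (k + 1))
    have h3 := ncard_avoidSet_eq hε (n + (k + 1))
    have h4 : 2 * (avoidSet ε (n + (k + 1))).ncard ≤
        (avoidSet ε (n + (k + 1) + 1)).ncard + 2 * (avoidSet ε n).ncard := by omega
    have h5 : (2 * (avoidSet ε (n + (k + 1))).ncard : ℝ) ≤
        (avoidSet ε (n + (k + 1) + 1)).ncard + 2 * (avoidSet ε n).ncard := by exact_mod_cast h4
    linarith

theorem log_le_scaleEntropy_f4 {ε : ℝ} {k : ℕ} (hk3 : 3 ≤ k) (hk : 2 ^ (k + 1) * ε ≤ 1 / 2)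
    (hε : 0 < ε) :
    ((Real.log (2 * (1 - 2 / 2 ^ (k + 1))) : ℝ) : EReal) ≤ scaleEntropy f4 ε := by
  have hp : (2 : ℝ) < 2 ^ (k + 1) := by
    calc (2 : ℝ) = 2 ^ 1 := by norm_num
      _ < 2 ^ (k + 1) := pow_lt_pow_right₀ one_lt_two (by omega)
  have hη1 : (2 / 2 ^ (k + 1) : ℝ) < 1 := by rwa [div_lt_one (by linarith)]
  have hpos : 0 < 2 * (1 - 2 / 2 ^ (k + 1) : ℝ) := by linarith
  rw [← ENNReal.log_ofReal_of_pos hpos, ← ExpGrowth.expGrowthSup_pow]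
  refine ExpGrowth.expGrowthSup_monotone fun n => ?_
  refine le_trans ?_ (ENat.toENNReal_mono (ncard_le_spanningNumber (subset_univ (avoidSet ε n))
    fun x hx y hy => avoidSet_separated hx hy))
  rw [← ENNReal.ofReal_pow hpos.le, ENat.toENNReal_coe, ← ENNReal.ofReal_natCast]
  exact ENNReal.ofReal_le_ofReal (pow_le_ncard_avoidSet hk3 hk hε n)

/-- The entropy of `f₄` at scale `ε` falls short of `log 2` by `O(ε)`. -/
theorem log_two_sub_le_scaleEntropy_f4 {ε : ℝ} (hε : 0 < ε) (hε1 : ε < 1 / 64) :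
    ((Real.log 2 - 16 * ε : ℝ) : EReal) ≤ scaleEntropy f4 ε := by
  -- With j = k + 1 the largest exponent such that 2^j ≤ 1/(2ε), the loss η = 2/2^j is at most 8ε.
  obtain ⟨j, hj1, hj2⟩ := exists_nat_pow_near (x := 1 / (2 * ε)) (y := 2)
    (by rw [le_div_iff₀ (by positivity)]; linarith) one_lt_two
  rw [le_div_iff₀ (by positivity)] at hj1
  rw [div_lt_iff₀ (by positivity)] at hj2
  have hj4 : 4 < j := by
    by_contra hcon
    have h1 : (2 : ℝ) ^ (j + 1) ≤ 2 ^ 5 := pow_le_pow_right₀ one_le_two (by omega)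
    nlinarith
  obtain ⟨k, rfl⟩ : ∃ k, j = k + 1 := ⟨j - 1, by omega⟩
  refine le_trans ?_ (log_le_scaleEntropy_f4 (k := k) (by omega) (by linarith) hε)
  rw [EReal.coe_le_coe_iff]
  have hp : (0 : ℝ) < 2 ^ (k + 1) := by positivity
  have h1 : (2 / 2 ^ (k + 1) : ℝ) ≤ 8 * ε := by
    rw [div_le_iff₀ hp]
    rw [pow_succ] at hj2
    linarith
  have h2 : (0 : ℝ) < 1 - 8 * ε := by linarith
  have h3 : Real.log (2 * (1 - 8 * ε)) ≤ Real.log (2 * (1 - 2 / 2 ^ (k + 1))) :=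
    Real.log_le_log (by linarith) (by linarith)
  rw [Real.log_mul two_ne_zero h2.ne'] at h3
  have h4 := Real.one_sub_inv_le_log_of_pos h2
  have h5 : (1 - 8 * ε)⁻¹ ≤ 1 + 16 * ε := by
    rw [inv_le_iff_one_le_mul₀ h2]
    nlinarith
  linarith

/-! ### Horseshoes accumulating on the critical point -/

/-- The sign `±1` of a symbol. -/
def symbolSign (b : Bool) : ℝ := if b then 1 else -1

theorem abs_symbolSign (b : Bool) : |symbolSign b| = 1 := by cases b <;> simp [symbolSign]

/-- The solution of `t(ω) = 1/2 + σ(ω₀) e t(shift ω)`. -/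
noncomputable def codedParam (e : ℝ) (ω : ℕ → Bool) : ℝ :=
  ∑' j : ℕ, 1 / 2 * e ^ j * ∏ i ∈ Finset.range j, symbolSign (ω i)

/-- The left shift of a sequence of symbols. -/
def shift (ω : ℕ → Bool) (i : ℕ) : Bool := ω (i + 1)

theorem shift_iterate_apply (n : ℕ) (ω : ℕ → Bool) (i : ℕ) : (shift^[n] ω) i = ω (i + n) := by
  induction n generalizing ω with
  | zero => rfl
  | succ n ih => rw [Function.iterate_succ_apply, ih]; rfl

section CodedParam

variable {e : ℝ}

theorem norm_codedParam_term_le (he0 : 0 ≤ e) (ω : ℕ → Bool) (j : ℕ) :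
    ‖1 / 2 * e ^ j * ∏ i ∈ Finset.range j, symbolSign (ω i)‖ ≤ 1 / 2 * e ^ j := by
  rw [norm_mul, norm_prod]
  simp only [Real.norm_eq_abs, abs_symbolSign, Finset.prod_const_one, mul_one]
  rw [abs_of_nonneg (by positivity)]

theorem summable_half_mul_pow (he0 : 0 ≤ e) (he : e ≤ 1 / 4) :
    Summable fun j : ℕ => 1 / 2 * e ^ j :=
  (summable_geometric_of_lt_one he0 (by linarith)).mul_left _

theorem summable_codedParam (he0 : 0 ≤ e) (he : e ≤ 1 / 4) (ω : ℕ → Bool) :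
    Summable fun j : ℕ => 1 / 2 * e ^ j * ∏ i ∈ Finset.range j, symbolSign (ω i) :=
  .of_norm_bounded (summable_half_mul_pow he0 he) (norm_codedParam_term_le he0 ω)

theorem continuous_codedParam (he0 : 0 ≤ e) (he : e ≤ 1 / 4) : Continuous (codedParam e) := by
  refine continuous_tsum (fun j => ?_) (summable_half_mul_pow he0 he)
    fun j ω => norm_codedParam_term_le he0 ω j
  have h : Continuous symbolSign := continuous_of_discreteTopology
  fun_prop

theorem codedParam_eq (he0 : 0 ≤ e) (he : e ≤ 1 / 4) (ω : ℕ → Bool) :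
    codedParam e ω = 1 / 2 + symbolSign (ω 0) * (e * codedParam e (shift ω)) := by
  rw [codedParam, (summable_codedParam he0 he ω).tsum_eq_zero_add, codedParam, ← tsum_mul_left,
    ← tsum_mul_left]
  congr 1
  · simp
  · refine tsum_congr fun j => ?_
    rw [Finset.prod_range_succ', pow_succ]
    simp only [shift]
    ring

theorem abs_codedParam_le (he0 : 0 ≤ e) (he : e ≤ 1 / 4) (ω : ℕ → Bool) :
    |codedParam e ω| ≤ 2 / 3 := by
  refine (tsum_of_norm_bounded (summable_half_mul_pow he0 he).hasSum
    (norm_codedParam_term_le he0 ω)).trans ?_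
  rw [tsum_mul_left, tsum_geometric_of_lt_one he0 (by linarith), ← div_eq_mul_inv,
    div_le_iff₀ (by linarith)]
  linarith

/-- The lower bound 1/2 − (1/4)(2/3) = 1/3 is what keeps the horseshoe away from the critical point.
-/
theorem codedParam_mem_Icc (he0 : 0 ≤ e) (he : e ≤ 1 / 4) (ω : ℕ → Bool) :
    codedParam e ω ∈ Icc (1 / 3) (2 / 3) := by
  have h1 := abs_le.1 (abs_codedParam_le he0 he ω)
  have h2 := abs_le.1 (abs_codedParam_le he0 he (shift ω))
  have h3 := codedParam_eq he0 he ω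
  refine ⟨?_, h1.2⟩
  cases h : ω 0 <;> simp only [h, symbolSign] at h3 <;> norm_num at h3 <;> nlinarith

end CodedParam

/-- The point with given coding in the horseshoe of `f₄^k` around the critical point. -/
noncomputable def codedPoint (k : ℕ) (ω : ℕ → Bool) : unitInterval :=
  sinSq (Real.pi / 2 * codedParam (1 / 2 ^ k) ω)

theorem one_div_two_pow_le {k : ℕ} (hk : 2 ≤ k) : (1 / 2 ^ k : ℝ) ≤ 1 / 4 := by
  refine one_div_le_one_div_of_le (by norm_num) ?_
  calc (4 : ℝ) = 2 ^ 2 := by norm_num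
    _ ≤ 2 ^ k := pow_le_pow_right₀ one_le_two hk

theorem continuous_codedPoint {k : ℕ} (hk : 2 ≤ k) : Continuous (codedPoint k) :=
  continuous_sinSq.comp
    (continuous_const.mul (continuous_codedParam (by positivity) (one_div_two_pow_le hk)))

theorem sinSq_nat_mul_pi_add (m : ℕ) (θ : ℝ) : sinSq (m * Real.pi + θ) = sinSq θ := by
  ext
  rw [coe_sinSq, coe_sinSq, add_comm, Real.sin_add_nat_mul_pi, mul_pow, ← pow_mul, mul_comm m,
    pow_mul]
  norm_num

theorem sinSq_neg (θ : ℝ) : sinSq (-θ) = sinSq θ := by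
  ext
  simp

/-- sin² is even and π-periodic, hence symmetric about every multiple of π/2. This is how one
application of `f4` forgets the first symbol. -/
theorem sinSq_add_sign_mul (m : ℕ) (b : Bool) (u : ℝ) :
    sinSq (m * (Real.pi / 2) + symbolSign b * u) = sinSq (m * (Real.pi / 2) + u) := by
  cases b with
  | true => simp [symbolSign]
  | false =>
    rw [← sinSq_neg, ← sinSq_nat_mul_pi_add m]
    congr 1
    simp [symbolSign]
    ring

theorem f4_iterate_codedPoint_of_le {k i : ℕ} (hk : 2 ≤ k) (ω : ℕ → Bool) :
    f4^[i + 1] (codedPoint k ω) = sinSq ((2 ^ i : ℕ) * (Real.pi / 2) +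
      2 ^ (i + 1) / 2 ^ k * (Real.pi / 2 * codedParam (1 / 2 ^ k) (shift ω))) := by
  rw [codedPoint, f4_iterate_sinSq, codedParam_eq (by positivity) (one_div_two_pow_le hk),
    ← sinSq_add_sign_mul _ (ω 0)]
  congr 1
  push_cast
  ring

theorem f4_iterate_codedPoint {k : ℕ} (hk : 2 ≤ k) (ω : ℕ → Bool) :
    f4^[k] (codedPoint k ω) = codedPoint k (shift ω) := by
  obtain ⟨i, rfl⟩ := Nat.exists_eq_add_of_le' hk
  rw [f4_iterate_codedPoint_of_le (i := i + 1) hk, div_self (by positivity), one_mul, pow_succ,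
    codedPoint]
  conv_rhs => rw [← sinSq_nat_mul_pi_add (2 ^ i)]
  congr 1
  push_cast
  ring

theorem f4_iterate_mul_codedPoint {k : ℕ} (hk : 2 ≤ k) (ω : ℕ → Bool) (m : ℕ) :
    f4^[k * m] (codedPoint k ω) = codedPoint k (shift^[m] ω) := by
  induction m with
  | zero => rfl
  | succ m ih =>
    rw [mul_add, mul_one, add_comm, Function.iterate_add_apply, ih, f4_iterate_codedPoint hk,
      Function.iterate_succ_apply']

theorem abs_codedParam_sub_le {k : ℕ} (hk : 2 ≤ k) (ω ω' : ℕ → Bool) :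
    |codedParam (1 / 2 ^ k) ω - codedParam (1 / 2 ^ k) ω'| ≤ 2 * (1 / 2 ^ k) := by
  have he0 : (0 : ℝ) ≤ 1 / 2 ^ k := by positivity
  have he := one_div_two_pow_le hk
  have h (ω : ℕ → Bool) : |codedParam (1 / 2 ^ k) ω - 1 / 2| ≤ 1 / 2 ^ k := by
    rw [codedParam_eq he0 he, add_sub_cancel_left, abs_mul, abs_symbolSign, one_mul, abs_mul,
      abs_of_nonneg he0]
    exact mul_le_of_le_one_right he0 ((abs_codedParam_le he0 he _).trans (by norm_num))
  have h1 := abs_sub_le (codedParam (1 / 2 ^ k) ω) (1 / 2) (codedParam (1 / 2 ^ k) ω')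
  rw [abs_sub_comm (1 / 2)] at h1
  linarith [h ω, h ω']

/-- All points of the horseshoe stay forever at distance at most `π / 2^k`. -/
theorem dist_f4_iterate_codedPoint_le {k : ℕ} (hk : 2 ≤ k) (i : ℕ) (ω ω' : ℕ → Bool) :
    dist (f4^[i] (codedPoint k ω)) (f4^[i] (codedPoint k ω')) ≤ Real.pi / 2 ^ k := by
  have hmain (ω ω' : ℕ → Bool) : Real.pi / 2 * |codedParam (1 / 2 ^ k) ω - codedParam (1 / 2 ^ k) ω'|
      ≤ Real.pi / 2 ^ k := by
    calc _ ≤ Real.pi / 2 * (2 * (1 / 2 ^ k)) :=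
          mul_le_mul_of_nonneg_left (abs_codedParam_sub_le hk ω ω') (by positivity)
      _ = _ := by ring
  induction i using Nat.strong_induction_on generalizing ω ω' with
  | _ i ih =>
    rcases lt_or_ge i k with hi | hi
    · cases i with
      | zero =>
        refine (dist_sinSq_le _ _).trans (le_trans (le_of_eq ?_) (hmain ω ω'))
        rw [← mul_sub, abs_mul, abs_of_nonneg (by positivity : (0 : ℝ) ≤ Real.pi / 2)]
      | succ i =>
        rw [f4_iterate_codedPoint_of_le hk, f4_iterate_codedPoint_of_le hk]
        refine (dist_sinSq_le _ _).trans (le_trans ?_ (hmain (shift ω) (shift ω')))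
        rw [add_sub_add_left_eq_sub, ← mul_sub, ← mul_sub, abs_mul, abs_mul,
          abs_of_nonneg (by positivity : (0 : ℝ) ≤ Real.pi / 2),
          abs_of_nonneg (by positivity : (0 : ℝ) ≤ 2 ^ (i + 1) / 2 ^ k)]
        -- Within a block the spread is that of the shifted parameters scaled by 2^(i+1)/2^k, which
        -- is at most 1.
        refine mul_le_of_le_one_left (by positivity) ?_
        rw [div_le_one (by positivity)]
        exact pow_le_pow_right₀ one_le_two hi.le
    · obtain ⟨j, rfl⟩ := Nat.exists_eq_add_of_le' hi
      rw [Function.iterate_add_apply, Function.iterate_add_apply, f4_iterate_codedPoint hk,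
        f4_iterate_codedPoint hk]
      exact ih j (by omega) _ _

/-- The distance of the points of the horseshoe to the critical point is at least this number. -/
noncomputable def horseshoeGap (k : ℕ) : ℝ := Real.sin (Real.pi * (1 / 2 ^ k * (1 / 3))) / 2

theorem horseshoeGap_pos {k : ℕ} (hk : 2 ≤ k) : 0 < horseshoeGap k := by
  have he := one_div_two_pow_le hk
  have hpi := Real.pi_pos
  refine half_pos (Real.sin_pos_of_pos_of_lt_pi (by positivity) ?_)
  nlinarith

/-- sin² of half the angle π/2 ± πet is (1 ± sin(πet))/2: the first symbol tells the side of 1/2,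
and t ≥ 1/3 bounds the distance. -/
theorem exists_codedPoint_eq {k : ℕ} (hk : 2 ≤ k) (ω : ℕ → Bool) :
    ∃ g, horseshoeGap k ≤ g ∧ (codedPoint k ω : ℝ) = 1 / 2 + symbolSign (ω 0) * g := by
  have he0 : (0 : ℝ) < 1 / 2 ^ k := by positivity
  have he := one_div_two_pow_le hk
  have hpi := Real.pi_pos
  obtain ⟨h1, h2⟩ := codedParam_mem_Icc he0.le he (shift ω)
  set t := codedParam (1 / 2 ^ k) (shift ω) with ht
  set e : ℝ := 1 / 2 ^ k
  refine ⟨Real.sin (Real.pi * (e * t)) / 2, ?_, ?_⟩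
  · refine div_le_div_of_nonneg_right (Real.sin_le_sin_of_le_of_le_pi_div_two ?_ ?_ ?_) zero_le_two
    · have : 0 < Real.pi * (e * (1 / 3)) := by positivity
      linarith
    · have : e * t ≤ 1 / 2 := by nlinarith
      nlinarith
    · exact mul_le_mul_of_nonneg_left (mul_le_mul_of_nonneg_left h1 he0.le) hpi.le
  · rw [codedPoint, coe_sinSq, Real.sin_sq_eq_half_sub, codedParam_eq he0.le he, ← ht,
      show 2 * (Real.pi / 2 * (1 / 2 + symbolSign (ω 0) * (e * t))) =
        Real.pi / 2 + symbolSign (ω 0) * (Real.pi * (e * t)) by ring]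
    cases ω 0
    all_goals
      simp [symbolSign, ← sub_eq_add_neg, Real.cos_pi_div_two_sub, Real.cos_add]
      try ring

theorem apply_zero_eq_of_dist_codedPoint_lt {k : ℕ} (hk : 2 ≤ k) {ω ω' : ℕ → Bool}
    (h : dist (codedPoint k ω) (codedPoint k ω') < 2 * horseshoeGap k) : ω 0 = ω' 0 := by
  obtain ⟨g, hg, h1⟩ := exists_codedPoint_eq hk ω
  obtain ⟨g', hg', h2⟩ := exists_codedPoint_eq hk ω'
  rw [Subtype.dist_eq, Real.dist_eq, h1, h2, abs_lt] at h
  cases h3 : ω 0 <;> cases h4 : ω' 0 <;> simp [h3, h4, symbolSign] at h ⊢ <;> linarith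

/-! ### The measures carried by the horseshoes -/

/-- The uniform Bernoulli measure on sequences of symbols. -/
noncomputable def coinMeasure : Measure (ℕ → Bool) :=
  Measure.infinitePi fun _ : ℕ => (PMF.uniformOfFintype Bool).toMeasure

instance : IsProbabilityMeasure coinMeasure := by unfold coinMeasure; infer_instance

theorem coinMeasure_pi (s : Finset ℕ) (t : ℕ → Set Bool) :
    coinMeasure (Set.pi s t) = ∏ i ∈ s, (PMF.uniformOfFintype Bool).toMeasure (t i) :=
  Measure.infinitePi_pi _ fun _ _ => MeasurableSet.of_discrete

theorem coinMeasure_cylinder (m : ℕ) (ω : ℕ → Bool) :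
    coinMeasure {ω' | ∀ i < m, ω' i = ω i} = (1 / 2) ^ m := by
  have h : {ω' : ℕ → Bool | ∀ i < m, ω' i = ω i} = Set.pi (Finset.range m) fun i => {ω i} := by
    ext ω'
    simp [Set.mem_pi]
  rw [h, coinMeasure_pi]
  simp

theorem measurable_shift : Measurable shift :=
  measurable_pi_lambda _ fun i => measurable_pi_apply (i + 1)

theorem measurePreserving_shift : MeasurePreserving shift coinMeasure coinMeasure := by
  refine ⟨measurable_shift, Measure.eq_infinitePi _ fun s t ht => ?_⟩
  rw [Measure.map_apply measurable_shift (.pi s.countable_toSet fun i _ => ht i)]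
  have h : shift ⁻¹' Set.pi s t =
      Set.pi (s.map (addRightEmbedding 1) : Finset ℕ) fun i => t (i - 1) := by
    ext ω
    simp [Set.mem_pi, shift]
  rw [h, coinMeasure_pi, Finset.prod_map]
  simp

/-- The average along `k` iterates of the measure carried by the horseshoe of `f₄^k`. -/
noncomputable def horseshoeMeasure (k : ℕ) : Measure unitInterval :=
  (k : ℝ≥0∞)⁻¹ • ∑ i ∈ Finset.range k, coinMeasure.map fun ω => f4^[i] (codedPoint k ω)

theorem measurable_f4_iterate_codedPoint {k : ℕ} (hk : 2 ≤ k) (i : ℕ) :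
    Measurable fun ω => f4^[i] (codedPoint k ω) :=
  ((continuous_f4.iterate i).comp (continuous_codedPoint hk)).measurable

theorem isProbabilityMeasure_horseshoeMeasure {k : ℕ} (hk : 2 ≤ k) :
    IsProbabilityMeasure (horseshoeMeasure k) := by
  constructor
  have h (i : ℕ) : coinMeasure.map (fun ω => f4^[i] (codedPoint k ω)) univ = 1 := by
    rw [Measure.map_apply (measurable_f4_iterate_codedPoint hk i) .univ, preimage_univ,
      measure_univ]
  rw [horseshoeMeasure, Measure.smul_apply, Measure.finsetSum_apply]
  simp only [h, Finset.sum_const, Finset.card_range, nsmul_eq_mul, mul_one, smul_eq_mul]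
  exact ENNReal.inv_mul_cancel (by simp; omega) (ENNReal.natCast_ne_top k)

/-- Pushing forward moves each term of the average to the next one. The last returns to the first
because f₄^k acts on codes as the shift, which preserves `coinMeasure`. -/
theorem measurePreserving_horseshoeMeasure {k : ℕ} (hk : 2 ≤ k) :
    MeasurePreserving f4 (horseshoeMeasure k) (horseshoeMeasure k) := by
  refine ⟨continuous_f4.measurable, ?_⟩
  have hstep (i : ℕ) : (coinMeasure.map fun ω => f4^[i] (codedPoint k ω)).map f4 =
      coinMeasure.map fun ω => f4^[i + 1] (codedPoint k ω) := by
    rw [Measure.map_map continuous_f4.measurable (measurable_f4_iterate_codedPoint hk i)]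
    congr 1
    ext1 ω
    rw [Function.iterate_succ_apply']
    rfl
  have hlast : (coinMeasure.map fun ω => f4^[k] (codedPoint k ω)) =
      coinMeasure.map fun ω => f4^[0] (codedPoint k ω) := by
    conv_rhs => rw [← measurePreserving_shift.map_eq]
    rw [Measure.map_map (measurable_f4_iterate_codedPoint hk 0) measurable_shift]
    congr 1
    ext1 ω
    exact f4_iterate_codedPoint hk ω
  rw [horseshoeMeasure, Measure.map_smul, ← Measure.mapₗ_apply_of_measurable
    continuous_f4.measurable, map_sum]
  simp only [Measure.mapₗ_apply_of_measurable continuous_f4.measurable, hstep]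
  congr 1
  obtain ⟨j, rfl⟩ := Nat.exists_eq_add_of_le' (show 1 ≤ k by omega)
  rw [Finset.sum_range_succ, hlast, ← Finset.sum_range_succ'
    (fun i => coinMeasure.map fun ω => f4^[i] (codedPoint (j + 1) ω))]

/-- The term i = 0 has weight 1/k in the average, so a complement of mass at most 1/(2k) misses at
most half of the codes. -/
theorem half_le_coinMeasure_preimage {k : ℕ} (hk : 2 ≤ k) {F : Set unitInterval}
    (hF : MeasurableSet F) (h : 1 - (k : ℝ≥0∞)⁻¹ * (1 / 2) ≤ horseshoeMeasure k F) :
    1 / 2 ≤ coinMeasure (codedPoint k ⁻¹' F) := by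
  have := isProbabilityMeasure_horseshoeMeasure hk
  have hk0 : (k : ℝ≥0∞)⁻¹ ≠ 0 := ENNReal.inv_ne_zero.2 (ENNReal.natCast_ne_top k)
  have hktop : (k : ℝ≥0∞)⁻¹ ≠ ∞ := ENNReal.inv_ne_top.2 (by simp; omega)
  have h1 : (k : ℝ≥0∞)⁻¹ * coinMeasure (codedPoint k ⁻¹' Fᶜ) ≤ horseshoeMeasure k Fᶜ := by
    rw [horseshoeMeasure, Measure.smul_apply, smul_eq_mul, Measure.finsetSum_apply]
    refine mul_le_mul_right ?_ _
    rw [← Measure.map_apply (continuous_codedPoint hk).measurable hF.compl]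
    exact Finset.single_le_sum (f := fun i => coinMeasure.map (fun ω => f4^[i] (codedPoint k ω)) Fᶜ)
      (fun _ _ => zero_le) (Finset.mem_range.2 (by omega : 0 < k))
  have h2 : horseshoeMeasure k Fᶜ ≤ (k : ℝ≥0∞)⁻¹ * (1 / 2) := by
    rw [prob_compl_eq_one_sub hF, tsub_le_iff_left]
    exact tsub_le_iff_right.1 h
  have h3 := (ENNReal.mul_le_mul_iff_right hk0 hktop).1 (h1.trans h2)
  rw [preimage_compl, prob_compl_eq_one_sub ((continuous_codedPoint hk).measurable hF),
    tsub_le_iff_left] at h3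
  have h4 : (1 / 2 : ℝ≥0∞) + 1 / 2 = 1 := ENNReal.add_halves 1
  refine (ENNReal.add_le_add_iff_right (a := 1 / 2) (by simp)).1 ?_
  rwa [h4]

/-- A set containing half of the horseshoe needs many balls. -/
theorem le_spanningNumber_of_half_le {k : ℕ} (hk : 2 ≤ k) {A : Set unitInterval} (n : ℕ)
    (hA : 1 / 2 ≤ coinMeasure (codedPoint k ⁻¹' A)) :
    1 / 2 * 2 ^ (n / k) ≤ (spanningNumber f4 A (horseshoeGap k) n : ℝ≥0∞) := by
  have hcard : ∀ s : Finset unitInterval,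
      (∀ x ∈ A, ∃ y ∈ s, ∀ i < n, dist (f4^[i] x) (f4^[i] y) < horseshoeGap k) →
      (1 / 2 * 2 ^ (n / k) : ℝ≥0∞) ≤ s.card := by
    intro s hs
    let G (y : unitInterval) : Set (ℕ → Bool) :=
      {ω | ∀ i < n, dist (f4^[i] (codedPoint k ω)) (f4^[i] y) < horseshoeGap k}
    -- Codes in one ball agree on the first n/k symbols, read off at the multiples of k, so each
    -- ball has coin measure at most that of a cylinder.
    have hG (y : unitInterval) : coinMeasure (G y) ≤ (1 / 2) ^ (n / k) := by
      rcases (G y).eq_empty_or_nonempty with h | ⟨ω, hω⟩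
      · simp [h]
      rw [← coinMeasure_cylinder _ ω]
      refine measure_mono fun ω' hω' i hi => ?_
      have hin : k * i < n := by
        have h1 : k * (i + 1) ≤ k * (n / k) := Nat.mul_le_mul_left k hi
        have h2 := Nat.mul_div_le n k
        rw [mul_add] at h1
        omega
      have h1 := hω (k * i) hin
      have h2 := hω' (k * i) hin
      rw [f4_iterate_mul_codedPoint hk] at h1 h2
      have h3 := apply_zero_eq_of_dist_codedPoint_lt hk
        ((dist_triangle_right _ _ _).trans_lt ((add_lt_add h2 h1).trans_eq (two_mul _).symm))
      simpa [shift_iterate_apply] using h3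
    have hcov : codedPoint k ⁻¹' A ⊆ ⋃ y ∈ s, G y := by
      intro ω hω
      obtain ⟨y, hy, h⟩ := hs _ hω
      exact mem_iUnion₂.2 ⟨y, hy, h⟩
    have h1 : (1 / 2 : ℝ≥0∞) ≤ s.card * (1 / 2) ^ (n / k) :=
      calc (1 / 2 : ℝ≥0∞) ≤ coinMeasure (⋃ y ∈ s, G y) := hA.trans (measure_mono hcov)
        _ ≤ ∑ y ∈ s, coinMeasure (G y) := measure_biUnion_finset_le _ _
        _ ≤ ∑ y ∈ s, (1 / 2 : ℝ≥0∞) ^ (n / k) := Finset.sum_le_sum fun y _ => hG y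
        _ = s.card * (1 / 2) ^ (n / k) := by rw [Finset.sum_const, nsmul_eq_mul]
    calc (1 / 2 * 2 ^ (n / k) : ℝ≥0∞) ≤ s.card * (1 / 2) ^ (n / k) * 2 ^ (n / k) := by gcongr
      _ = s.card := by
        rw [mul_assoc, ← mul_pow, one_div, ENNReal.inv_mul_cancel two_ne_zero ENNReal.ofNat_ne_top,
          one_pow, mul_one]
  rcases eq_or_ne (spanningNumber f4 A (horseshoeGap k) n) ⊤ with h | h
  · rw [h]
    simp
  · obtain ⟨s, hs, hs'⟩ := (Dynamics.coverMincard_finite_iff f4 A (distRel _ (horseshoeGap k)) n).1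
      (lt_top_iff_ne_top.2 h)
    rw [spanningNumber, ← hs']
    refine (hcard s fun x hx => ?_).trans_eq (by simp)
    obtain ⟨y, hy, hxy⟩ := hs hx
    exact ⟨y, hy, mem_dynEntourage_distRel.1 hxy⟩

theorem expGrowthSup_ge_of_half_mul_le {k : ℕ} (hk : k ≠ 0) {u : ℕ → ℝ≥0∞}
    (h : ∀ n, 1 / 2 * 2 ^ (n / k) ≤ u n) :
    ((Real.log 2 / k : ℝ) : EReal) ≤ ExpGrowth.expGrowthSup u := by
  have hexp := Real.exp_pos (Real.log 2 / k)
  rw [← Real.log_exp (Real.log 2 / k), ← ENNReal.log_ofReal_of_pos hexp,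
    ← ExpGrowth.expGrowthSup_pow]
  set r := Real.exp (Real.log 2 / k)
  have hr1 : 1 ≤ r := Real.one_le_exp (by positivity)
  have hrk : r ^ k = 2 := by
    rw [← Real.exp_nat_mul, mul_div_cancel₀ _ (by exact_mod_cast hk), Real.exp_log two_pos]
  -- Here r = 2^(1/k). Rounding n/k down costs at most a factor 2, whence the constant 1/4,
  -- invisible to the growth rate.
  refine ExpGrowth.expGrowthSup_of_eventually_ge (b := 1 / 2 * (1 / 2)) (by simp)
    (Eventually.of_forall fun n => le_trans ?_ (h n))
  rw [mul_assoc]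
  refine mul_le_mul_right ?_ _
  have h1 : r ^ n ≤ 2 ^ (n / k) * 2 := by
    conv_lhs => rw [← Nat.div_add_mod n k, pow_add, pow_mul, hrk]
    refine mul_le_mul_of_nonneg_left ?_ (by positivity)
    rw [← hrk]
    exact pow_le_pow_right₀ hr1 (Nat.mod_lt n (Nat.pos_of_ne_zero hk)).le
  have h2 : ENNReal.ofReal r ^ n ≤ 2 ^ (n / k) * 2 := by
    rw [← ENNReal.ofReal_pow hexp.le]
    refine (ENNReal.ofReal_le_ofReal h1).trans_eq ?_
    rw [ENNReal.ofReal_mul (by positivity), ENNReal.ofReal_pow zero_le_two, ENNReal.ofReal_ofNat]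
  calc (1 / 2 : ℝ≥0∞) * ENNReal.ofReal r ^ n ≤ 1 / 2 * (2 ^ (n / k) * 2) := by gcongr
    _ = 2 ^ (n / k) * (1 / 2 * 2) := by ring
    _ = 2 ^ (n / k) := by
      rw [one_div, ENNReal.inv_mul_cancel two_ne_zero ENNReal.ofNat_ne_top, mul_one]

theorem log_two_div_le_localEntropy_f4 {k : ℕ} (hk : 2 ≤ k) {ε : ℝ} (hε : Real.pi / 2 ^ k < ε) :
    ((Real.log 2 / k : ℝ) : EReal) ≤ localEntropy f4 ε := by
  have hprob := isProbabilityMeasure_horseshoeMeasure hk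
  refine le_iSup_of_le (horseshoeMeasure k) (le_iSup₂_of_le hprob
    (measurePreserving_horseshoeMeasure hk) ?_)
  have hlt : 1 - (k : ℝ≥0∞)⁻¹ * (1 / 2) < 1 :=
    ENNReal.sub_lt_self ENNReal.one_ne_top one_ne_zero
      (mul_ne_zero (ENNReal.inv_ne_zero.2 (ENNReal.natCast_ne_top k)) (by simp))
  refine le_iSup₂_of_le _ hlt (le_iInf fun F => le_iInf₂ fun hF hμF => ?_)
  have hhalf := half_le_coinMeasure_preimage hk hF hμF
  obtain ⟨ω₀, hω₀⟩ : (codedPoint k ⁻¹' F).Nonempty := by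
    refine nonempty_of_measure_ne_zero (μ := coinMeasure) fun h0 => ?_
    rw [h0] at hhalf
    simp at hhalf
  refine le_iSup₂_of_le (horseshoeGap k) (horseshoeGap_pos hk)
    (expGrowthSup_ge_of_half_mul_le (by omega) fun n => le_iSup₂_of_le _ hω₀ ?_)
  -- The ball around any coded point contains the whole horseshoe, so intersecting F with it loses
  -- no code.
  refine le_spanningNumber_of_half_le hk n (hhalf.trans (measure_mono fun ω hω => ⟨hω, ?_⟩))
  exact fun i _ => (dist_f4_iterate_codedPoint_le hk i ω ω₀).trans_lt hε

theorem exists_le_localEntropy_f4 : ∃ C : ℝ, 0 < C ∧ ∀ ε : ℝ, 0 < ε → ε < 1 / 2 →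
    ((C / |Real.log ε| : ℝ) : EReal) ≤ localEntropy f4 ε := by
  have hlog2 : 0 < Real.log 2 := Real.log_pos one_lt_two
  refine ⟨Real.log 2 ^ 2 / 4, by positivity, fun ε h0 h1 => ?_⟩
  have hL : Real.log 2 < -Real.log ε := by
    rw [← Real.log_inv]
    refine Real.log_lt_log two_pos ?_
    rw [lt_inv_comm₀ two_pos h0]
    linarith
  have habs : |Real.log ε| = -Real.log ε := abs_of_neg (by linarith)
  rw [habs]
  set L := -Real.log ε with hLdef
  have hq : 0 < L / Real.log 2 := div_pos (by linarith) hlog2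
  -- The added 2 absorbs π < 4 and gives π/2^k < ε; since L > log 2, also k log 2 ≤ L + 3 log 2 ≤
  -- 4L, which explains C = (log 2)²/4.
  set k := ⌈L / Real.log 2⌉₊ + 2 with hkdef
  have hk1 : L / Real.log 2 + 2 ≤ k := by
    rw [hkdef]
    push_cast
    linarith [Nat.le_ceil (L / Real.log 2)]
  have hk2 : (k : ℝ) < L / Real.log 2 + 3 := by
    rw [hkdef]
    push_cast
    linarith [Nat.ceil_lt_add_one hq.le]
  have hsmall : Real.pi / 2 ^ k < ε := by
    rw [div_lt_iff₀ (by positivity), ← div_lt_iff₀' h0,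
      ← Real.log_lt_log_iff (by positivity) (by positivity), Real.log_pow,
      Real.log_div Real.pi_ne_zero h0.ne']
    have h4 : Real.log Real.pi < 2 * Real.log 2 := by
      have h5 : (2 : ℝ) * Real.log 2 = Real.log 4 := by
        rw [show (4 : ℝ) = 2 ^ 2 by norm_num, Real.log_pow]
        norm_num
      rw [h5]
      exact Real.log_lt_log Real.pi_pos Real.pi_lt_four
    have h6 := mul_le_mul_of_nonneg_right hk1 hlog2.le
    rw [add_mul, div_mul_cancel₀ _ hlog2.ne'] at h6
    linarith
  refine le_trans ?_ (log_two_div_le_localEntropy_f4 (k := k) (by omega) hsmall)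
  rw [EReal.coe_le_coe_iff, div_le_div_iff₀ (by linarith) (by positivity)]
  have h7 : (k : ℝ) * Real.log 2 ≤ 4 * L := by
    have := mul_le_mul_of_nonneg_right hk2.le hlog2.le
    rw [add_mul, div_mul_cancel₀ _ hlog2.ne'] at this
    linarith
  nlinarith

/-! ### Finiteness and asymptotics of the entropies -/

theorem topEntropy_f4_ne_top : topEntropy f4 ≠ ⊤ :=
  (topEntropy_f4_le.trans_lt (EReal.coe_lt_top _)).ne

theorem topEntropy_f4_ne_bot : topEntropy f4 ≠ ⊥ :=
  (EReal.bot_lt_zero.trans_le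
    ((scaleEntropy_nonneg f4 1).trans (scaleEntropy_le_topEntropy f4 one_pos))).ne'

theorem scaleEntropy_f4_ne_top {ε : ℝ} (hε : 0 < ε) : scaleEntropy f4 ε ≠ ⊤ :=
  ((scaleEntropy_f4_le hε).trans_lt (EReal.coe_lt_top _)).ne

theorem scaleEntropy_f4_ne_bot (ε : ℝ) : scaleEntropy f4 ε ≠ ⊥ :=
  (EReal.bot_lt_zero.trans_le (scaleEntropy_nonneg f4 ε)).ne'

theorem localEntropy_f4_ne_top (ε : ℝ) : localEntropy f4 ε ≠ ⊤ :=
  (((localEntropy_le_topEntropy f4 ε).trans topEntropy_f4_le).trans_lt (EReal.coe_lt_top _)).ne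

theorem topEntropy_sub_scaleEntropy_isBigO :
    (fun ε : ℝ => (topEntropy f4).toReal - (scaleEntropy f4 ε).toReal)
      =O[𝓝[>] (0 : ℝ)] fun ε : ℝ => ε := by
  refine Asymptotics.IsBigO.of_bound 16 ?_
  filter_upwards [Ioo_mem_nhdsGT (show (0 : ℝ) < 1 / 64 by norm_num)] with ε ⟨h0, h1⟩
  have h2 : (scaleEntropy f4 ε).toReal ≤ (topEntropy f4).toReal :=
    EReal.toReal_le_toReal (scaleEntropy_le_topEntropy f4 h0) (scaleEntropy_f4_ne_bot ε)
      topEntropy_f4_ne_top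
  have h3 : (topEntropy f4).toReal ≤ Real.log 2 :=
    EReal.toReal_le_toReal topEntropy_f4_le topEntropy_f4_ne_bot (EReal.coe_ne_top _)
  have h4 : Real.log 2 - 16 * ε ≤ (scaleEntropy f4 ε).toReal :=
    EReal.toReal_le_toReal (log_two_sub_le_scaleEntropy_f4 h0 h1) (EReal.coe_ne_bot _)
      (scaleEntropy_f4_ne_top h0)
  rw [Real.norm_of_nonneg (by linarith), Real.norm_of_nonneg h0.le]
  linarith

/-- The quotient is ε^(1−α)|log ε|, which tends to 0. -/
theorem isLittleO_rpow_div_abs_log {α : ℝ} (hα : α < 1) :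
    (fun ε : ℝ => ε) =o[𝓝[>] (0 : ℝ)] fun ε : ℝ => ε ^ α / |Real.log ε| := by
  refine (Asymptotics.isLittleO_iff_tendsto' ?_).2 ?_
  · filter_upwards [Ioo_mem_nhdsGT one_pos] with ε ⟨h0, h1⟩ h
    have := (div_pos (Real.rpow_pos_of_pos h0 α) (abs_pos.2 (Real.log_neg h0 h1).ne)).ne'
    contradiction
  · have h := (tendsto_log_mul_rpow_nhdsGT_zero (sub_pos.2 hα)).abs
    rw [abs_zero] at h
    refine h.congr' ?_
    filter_upwards [self_mem_nhdsWithin] with ε h0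
    have h0 : 0 < ε := h0
    rw [abs_mul, abs_of_pos (Real.rpow_pos_of_pos h0 _), Real.rpow_sub h0, Real.rpow_one,
      div_div_eq_mul_div]
    ring

theorem topEntropy_sub_scaleEntropy_isLittleO {α : ℝ} (hα : α < 1) :
    (fun ε : ℝ => (topEntropy f4).toReal - (scaleEntropy f4 ε).toReal)
      =o[𝓝[>] (0 : ℝ)] fun ε : ℝ => ε ^ α / |Real.log ε| :=
  topEntropy_sub_scaleEntropy_isBigO.trans_isLittleO (isLittleO_rpow_div_abs_log hα)

theorem rpow_div_abs_log_isBigO_localEntropy {α : ℝ} (hα : 0 < α) :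
    (fun ε : ℝ => ε ^ α / |Real.log ε|)
      =O[𝓝[>] (0 : ℝ)] fun ε : ℝ => (localEntropy f4 ε).toReal := by
  obtain ⟨C, hC, h⟩ := exists_le_localEntropy_f4
  refine Asymptotics.IsBigO.of_bound C⁻¹ ?_
  filter_upwards [Ioo_mem_nhdsGT (show (0 : ℝ) < 1 / 2 by norm_num)] with ε ⟨h0, h1⟩
  have h2 : C / |Real.log ε| ≤ (localEntropy f4 ε).toReal :=
    EReal.toReal_le_toReal (h ε h0 h1) (EReal.coe_ne_bot _) (localEntropy_f4_ne_top ε)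
  have h3 : ε ^ α ≤ 1 := Real.rpow_le_one h0.le (by linarith) hα.le
  rw [Real.norm_of_nonneg (by positivity), Real.norm_of_nonneg (le_trans (by positivity) h2)]
  calc ε ^ α / |Real.log ε| ≤ 1 / |Real.log ε| := div_le_div_of_nonneg_right h3 (abs_nonneg _)
    _ = C⁻¹ * (C / |Real.log ε|) := by rw [← mul_div_assoc, inv_mul_cancel₀ hC.ne']
    _ ≤ _ := mul_le_mul_of_nonneg_left h2 (by positivity)

end EpsEntropy

theorem mainTheorem7 :
    -- `0` is a repelling fixed point with a (non degenerate) homoclinic tangency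
    (EpsEntropy.f4 0 = 0 ∧ 1 < |EpsEntropy.intervalDeriv 1 EpsEntropy.f4 0| ∧
      ∀ r : ℕ∞, 2 ≤ r → EpsEntropy.HasHomoclinicTangency r EpsEntropy.f4 {0}) ∧
    -- the local entropy is at least of order `1/|log ε|`
    (∃ C : ℝ, 0 < C ∧ ∀ ε : ℝ, 0 < ε → ε < 1 / 2 →
      ((C / |Real.log ε| : ℝ) : EReal) ≤ EpsEntropy.localEntropy EpsEntropy.f4 ε) ∧
    -- the entropies are finite
    (EpsEntropy.topEntropy EpsEntropy.f4 ≠ ⊤ ∧ EpsEntropy.topEntropy EpsEntropy.f4 ≠ ⊥ ∧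
      ∀ ε : ℝ, 0 < ε →
        EpsEntropy.scaleEntropy EpsEntropy.f4 ε ≠ ⊤ ∧
        EpsEntropy.scaleEntropy EpsEntropy.f4 ε ≠ ⊥ ∧
        EpsEntropy.localEntropy EpsEntropy.f4 ε ≠ ⊤) ∧
    -- `h(f₄) - h(f₄, ε) = o(ε^α / |log ε|)`
    (∀ α : ℝ, 0 < α → α < 1 →
      (fun ε : ℝ => (EpsEntropy.topEntropy EpsEntropy.f4).toReal -
          (EpsEntropy.scaleEntropy EpsEntropy.f4 ε).toReal)
        =o[𝓝[>] (0 : ℝ)] fun ε : ℝ => ε ^ α / |Real.log ε|) ∧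
    -- in particular the difference is negligible with respect to the local entropy
    (fun ε : ℝ => (EpsEntropy.topEntropy EpsEntropy.f4).toReal -
        (EpsEntropy.scaleEntropy EpsEntropy.f4 ε).toReal)
      =o[𝓝[>] (0 : ℝ)] fun ε : ℝ => (EpsEntropy.localEntropy EpsEntropy.f4 ε).toReal := by
  refine ⟨⟨EpsEntropy.f4_zero, ?_, EpsEntropy.hasHomoclinicTangency_f4⟩,
    EpsEntropy.exists_le_localEntropy_f4,
    ⟨EpsEntropy.topEntropy_f4_ne_top, EpsEntropy.topEntropy_f4_ne_bot, fun ε hε =>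
      ⟨EpsEntropy.scaleEntropy_f4_ne_top hε, EpsEntropy.scaleEntropy_f4_ne_bot ε,
        EpsEntropy.localEntropy_f4_ne_top ε⟩⟩,
    fun α _ hα => EpsEntropy.topEntropy_sub_scaleEntropy_isLittleO hα,
    (EpsEntropy.topEntropy_sub_scaleEntropy_isLittleO one_half_lt_one).trans_isBigO
      (EpsEntropy.rpow_div_abs_log_isBigO_localEntropy one_half_pos)⟩
  have h := EpsEntropy.intervalDeriv_one_f4_iterate_zero 1
  rw [Function.iterate_one] at h
  rw [h]
  norm_num
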